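/- Let $\beta = i-1$ and $\mathcal D=\{0,\pm 1,\pm i\}$. A representation of a Gaussian integer $x\in\mathbb Z[i]$ is a finite string $d_n\cdots d_1d_0$ of digits $d_k\in\mathcal D$ with $x=\sum_{k=0}^n d_k\beta^k$, where strings differing only by leading zeros are identified (equivalently, the leading digit is required to be non-zero, and $0$ is represented by the empty string). It is optimal if its number of non-zero digits is minimal among all representations of $x$. It is a $3$-NAF representation of $x$ if any three consecutive digits (the string being continued by leading zeros) contain at most one non-zero digit; every Gaussian integer is known to have a unique $3$-NAF representation. Define $(r_N)_{N\ge 0}$ by $r_0=r_1=1$, $r_2=3$, $r_3=8$, $r_4=17$ and $r_{N+3}=r_{N+2}+2r_{N+1}+2r_N$ for all $N\ge 2$. Let $N\ge 1$ be an integer. (1) If the $3$-NAF representation of a Gaussian integer $x$ contains exactly $N$ non-zero digits, then $x$ has at most $r_N$ optimal representations. (2) If $N\ge 4$, then there are exactly $16$ Gaussian integers $x\in\mathbb Z[i]\setminus\beta\mathbb Z[i]$ whose $3$-NAF representation contains exactly $N$ non-zero digits and which have exactly $r_N$ optimal representations. -/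

import Mathlib

/-!
Representations of Gaussian integers in base `β = i - 1` with digits `0, ±1, ±i`.
A digit string `d_n ⋯ d_1 d_0` is stored as the list `[d_0, d_1, …, d_n]`, least significant
digit first.  Strings that differ only by leading zeros are identified by admitting only
normalized strings, whose leading digit `d_n` is non-zero; zero is represented by the empty string.
-/
namespace GaussianNAF

/-- The base `β = i - 1`. -/
def base : GaussianInt := ⟨-1, 1⟩

/-- The digit set `{0, 1, -1, i, -i}`. -/
def digitSet : Set GaussianInt := {0, 1, -1, ⟨0, 1⟩, ⟨0, -1⟩}

/-- The digit at position `k`; it is zero beyond the end of the string. -/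
def digit (s : List GaussianInt) (k : ℕ) : GaussianInt := s.getD k 0

/-- The number `∑ k, d_k β ^ k` represented by a digit string. -/
def value (s : List GaussianInt) : GaussianInt :=
  ∑ k ∈ Finset.range s.length, digit s k * base ^ k

/-- The number of non-zero digits (Hamming weight) of a digit string. -/
def weight (s : List GaussianInt) : ℕ :=
  s.countP (fun d => d ≠ 0)

/-- `s` is a (normalized) representation of `x`. -/
structure IsRepresentation (s : List GaussianInt) (x : GaussianInt) : Prop where
  digits_mem : ∀ d ∈ s, d ∈ digitSet
  leading_ne_zero : ∀ h : s ≠ [], s.getLast h ≠ 0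
  value_eq : value s = x

/-- `s` is a representation of `x` of minimal Hamming weight. -/
def IsOptimal (s : List GaussianInt) (x : GaussianInt) : Prop :=
  IsRepresentation s x ∧ ∀ t, IsRepresentation t x → weight s ≤ weight t

/-- `s` is a width-`W` non-adjacent form of `x`: a representation of `x` in which any `W`
consecutive digits (the string being continued by leading zeros) contain at most one
non-zero digit. -/
def IsNAF (W : ℕ) (s : List GaussianInt) (x : GaussianInt) : Prop :=
  IsRepresentation s x ∧
    ∀ j : ℕ, ((Finset.Ico j (j + W)).filter (fun k => digit s k ≠ 0)).card ≤ 1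

/-- The number of optimal representations of `x`, possibly infinite a priori. -/
noncomputable def numOptimal (x : GaussianInt) : ℕ∞ :=
  {s : List GaussianInt | IsOptimal s x}.encard

/-- `r_0 = r_1 = 1`, `r_2 = 3`, `r_3 = 8`, `r_4 = 17`, and
`r_{N+3} = r_{N+2} + 2 r_{N+1} + 2 r_N` for `N ≥ 2`. -/
def r : ℕ → ℕ
  | 0 => 1
  | 1 => 1
  | 2 => 3
  | 3 => 8
  | 4 => 17
  | n + 5 => r (n + 4) + 2 * r (n + 3) + 2 * r (n + 2)

end GaussianNAF

/-!
Let `count k x` be the number of representations of `x` with exactly `k` non-zero digits.  A multiple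
of `β = i - 1` can only have lowest digit `0`, so `count k (β * x) = count k x`; for all other `x` the
lowest digit is any of the four units `u`, and `count k x = ∑ u, count (k - 1) ((x - u) / β)`.

Peeling off low digits from `z + c`, where `z` is read from its 3-NAF and `c` is a carry of norm at
most `5`, leads to carries of norm at most `5` again.  A finite check along this closed system
shows that adding `c` lowers the minimal weight by at most `2`, by at most `1` if `c` has norm at
most `4`, and not at all if `c = 0` (`HasNAFWeight.count_eq_zero`); so 3-NAFs are optimal, and for `z`
of 3-NAF weight `n` the number of optimal representations is `f = count n z`.

After discarding the terms that vanish for this reason, only `f` and, for units `u`, the numbers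
`near n z u = count (n - 1) (z + u)` and `diag n z u = count (n - 1) (z + u - i * u)` are left.  Going
from `z` to `v + β ^ 3 * z` replaces `f` by `f + 2 * a + 2 * b + e` with `a = near n z v`,
`b = near n z (-i * v)`, `e = diag n z v`, and the new `near` and `diag` are `a + b + e`, `a`, `f`, `b`
and `b`, `a`, `0`, `0` in the directions `v`, `i * v`, `-v`, `-i * v`.  The bound `f ≤ r n` follows by
induction, together with the bounds that it implies after one and after two further digits and with
`a + b + e ≤ f` (`Bounds`, `HasNAFWeight.bounds`).  Wider gaps between non-zero digits only lower the
counts.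

For large weights the bound is attained only if each new digit is `-w` or `-i * w`, with `w` the digit
before it, and the count at the corresponding carry is maximal too
(`HasNAFWeight.extremal_cons`).  Exactly one of the two choices has that property, so from weight `4`
on every extremal number is continued to the next weight by exactly one digit
(`existsUnique_cons_mem_extremal`).  Hence the number of extremal numbers does not change from
weight `4` on, and at weight `4` it is `16` by enumeration (`encard_extremal_four`).
-/

namespace GaussianNAF

/-! ### Divisibility by the base -/

/-- The imaginary unit as a Gaussian integer. -/
def I : GaussianInt := ⟨0, 1⟩

/-- The non-zero digits, which are the units of `ℤ[i]`. -/
def units : List GaussianInt := [1, I, -1, -I]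

/-- The quotient by `i - 1` of a Gaussian integer that is divisible by it. -/
def divBase (x : GaussianInt) : GaussianInt := ⟨(x.im - x.re) / 2, (-x.re - x.im) / 2⟩

lemma base_mul_re (y : GaussianInt) : (base * y).re = -y.re - y.im := by
  simp [base]; ring

lemma base_mul_im (y : GaussianInt) : (base * y).im = y.re - y.im := by
  simp [base]; ring

lemma divBase_base_mul (y : GaussianInt) : divBase (base * y) = y := by
  ext
  · simp only [divBase, base_mul_re, base_mul_im]; omega
  · simp only [divBase, base_mul_re, base_mul_im]; omega

lemma base_mul_divBase {x : GaussianInt} (h : (x.re + x.im) % 2 = 0) :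
    base * divBase x = x := by
  ext
  · rw [base_mul_re]; simp only [divBase]; omega
  · rw [base_mul_im]; simp only [divBase]; omega

lemma base_dvd_iff (x : GaussianInt) : base ∣ x ↔ (x.re + x.im) % 2 = 0 := by
  constructor
  · rintro ⟨y, rfl⟩
    rw [base_mul_re, base_mul_im]; omega
  · exact fun h => ⟨divBase x, (base_mul_divBase h).symm⟩

lemma base_ne_zero : base ≠ 0 := by decide

lemma base_mul_injective : Function.Injective (fun x : GaussianInt => base * x) := by
  intro x y h
  rw [← divBase_base_mul x, ← divBase_base_mul y]
  exact congrArg divBase h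

lemma mem_units {u : GaussianInt} : u ∈ units ↔ u = 1 ∨ u = I ∨ u = -1 ∨ u = -I := by
  simp [units]

lemma mem_digitSet {d : GaussianInt} : d ∈ digitSet ↔ d = 0 ∨ d ∈ units := by
  have h : (⟨0, -1⟩ : GaussianInt) = -I := by decide
  simp only [digitSet, mem_units, Set.mem_insert_iff, Set.mem_singleton_iff, h, I]
  tauto

lemma not_base_dvd_of_mem_units {u : GaussianInt} (hu : u ∈ units) : ¬ base ∣ u := by
  rw [base_dvd_iff]
  revert u; decide

lemma ne_zero_of_mem_units {u : GaussianInt} (hu : u ∈ units) : u ≠ 0 := by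
  rintro rfl
  exact not_base_dvd_of_mem_units hu (dvd_zero _)

lemma base_dvd_sub_unit {x u : GaussianInt} (hx : ¬ base ∣ x) (hu : u ∈ units) :
    base * divBase (x - u) = x - u := by
  have h := not_base_dvd_of_mem_units hu
  apply base_mul_divBase
  rw [base_dvd_iff] at hx h
  simp only [Zsqrtd.re_sub, Zsqrtd.im_sub]
  omega

/-! ### Representations of given weight -/

lemma value_cons (d : GaussianInt) (s : List GaussianInt) :
    value (d :: s) = d + base * value s := by
  simp only [value, List.length_cons, Finset.sum_range_succ', digit, List.getD_cons_succ,
    List.getD_cons_zero, pow_zero, mul_one, Finset.mul_sum]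
  rw [add_comm]
  congr 1
  refine Finset.sum_congr rfl fun k _ => ?_
  ring

lemma weight_zero_cons (s : List GaussianInt) : weight (0 :: s) = weight s := by
  simp [weight]

lemma weight_unit_cons {u : GaussianInt} (hu : u ∈ units) (s : List GaussianInt) :
    weight (u :: s) = weight s + 1 := by
  simp [weight, ne_zero_of_mem_units hu]

lemma isRepresentation_nil {x : GaussianInt} : IsRepresentation [] x ↔ x = 0 := by
  constructor
  · intro h; simpa [value] using h.value_eq.symm
  · rintro rfl; exact ⟨by simp, by simp, by simp [value]⟩

lemma isRepresentation_cons {d x : GaussianInt} {s : List GaussianInt} :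
    IsRepresentation (d :: s) x ↔
      d ∈ digitSet ∧ (s = [] → d ≠ 0) ∧ ∃ y, x = d + base * y ∧ IsRepresentation s y := by
  constructor
  · intro h
    refine ⟨h.digits_mem d (by simp), ?_, value s, ?_, ?_, ?_, rfl⟩
    · rintro rfl; simpa using h.leading_ne_zero (by simp)
    · rw [← value_cons]; exact h.value_eq.symm
    · exact fun e he => h.digits_mem e (by simp [he])
    · intro hs
      have := h.leading_ne_zero (by simp)
      rwa [List.getLast_cons hs] at this
  · rintro ⟨hd, h0, y, rfl, h⟩
    refine ⟨?_, ?_, by rw [value_cons, h.value_eq]⟩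
    · intro e he
      rcases List.mem_cons.1 he with rfl | he
      · exact hd
      · exact h.digits_mem e he
    · intro _
      by_cases hs : s = []
      · subst hs; simpa using h0 rfl
      · rw [List.getLast_cons hs]; exact h.leading_ne_zero hs

/-- The normalized representations of `x` that have exactly `k` non-zero digits.  The weight `k` is
an integer, so that there are none for negative `k`. -/
def representations (k : ℤ) (x : GaussianInt) : Set (List GaussianInt) :=
  {s | IsRepresentation s x ∧ (weight s : ℤ) = k}

/-- The number of normalized representations of `x` that have exactly `k` non-zero digits. -/
noncomputable def count (k : ℤ) (x : GaussianInt) : ℕ := (representations k x).ncard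

lemma representations_base_mul (k : ℤ) {x : GaussianInt} (hx : x ≠ 0) :
    representations k (base * x) = List.cons 0 '' representations k x := by
  ext s
  simp only [representations, Set.mem_image, Set.mem_ofPred_eq]
  constructor
  · rintro ⟨h, hk⟩
    cases s with
    | nil => exact absurd (isRepresentation_nil.1 h) (mul_ne_zero base_ne_zero hx)
    | cons d s =>
      obtain ⟨hd, -, y, hy, hs⟩ := isRepresentation_cons.1 h
      have hd0 : d = 0 := by
        refine (mem_digitSet.1 hd).resolve_right fun hu => not_base_dvd_of_mem_units hu ?_
        exact (dvd_add_left (dvd_mul_right base y)).1 (hy ▸ dvd_mul_right base x)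
      subst hd0
      rw [zero_add] at hy
      obtain rfl := base_mul_injective hy
      exact ⟨s, ⟨hs, by rwa [weight_zero_cons] at hk⟩, rfl⟩
  · rintro ⟨s, ⟨h, hk⟩, rfl⟩
    refine ⟨isRepresentation_cons.2 ⟨mem_digitSet.2 (Or.inl rfl), ?_, x, by simp, h⟩, ?_⟩
    · rintro rfl; exact absurd (isRepresentation_nil.1 h) hx
    · rwa [weight_zero_cons]

lemma representations_of_not_base_dvd (k : ℤ) {x : GaussianInt} (hx : ¬ base ∣ x) :
    representations (k + 1) x =
      {s | ∃ u ∈ units, s ∈ List.cons u '' representations k (divBase (x - u))} := by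
  ext s
  simp only [representations, Set.mem_image, Set.mem_ofPred_eq]
  constructor
  · rintro ⟨h, hk⟩
    cases s with
    | nil => exact absurd (isRepresentation_nil.1 h ▸ dvd_zero base) hx
    | cons d s =>
      obtain ⟨hd, -, y, rfl, hs⟩ := isRepresentation_cons.1 h
      have hu : d ∈ units := by
        refine (mem_digitSet.1 hd).resolve_left ?_
        rintro rfl
        exact hx (by simp)
      refine ⟨d, hu, s, ⟨?_, ?_⟩, rfl⟩
      · rwa [add_sub_cancel_left, divBase_base_mul]
      · rw [weight_unit_cons hu] at hk; push_cast at hk; omega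
  · rintro ⟨u, hu, s, ⟨h, hk⟩, rfl⟩
    refine ⟨isRepresentation_cons.2 ⟨mem_digitSet.2 (Or.inr hu), fun _ => ne_zero_of_mem_units hu,
      _, ?_, h⟩, ?_⟩
    · rw [base_dvd_sub_unit hx hu]; ring
    · rw [weight_unit_cons hu]; push_cast; omega

lemma eq_nil_of_isRepresentation_zero {s : List GaussianInt} (h : IsRepresentation s 0) :
    s = [] := by
  induction s with
  | nil => rfl
  | cons d s ih =>
    obtain ⟨hd, h0, y, hy, hs⟩ := isRepresentation_cons.1 h
    have hd0 : d = 0 := by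
      refine (mem_digitSet.1 hd).resolve_right fun hu => not_base_dvd_of_mem_units hu ?_
      exact (dvd_add_left (dvd_mul_right base y)).1 (hy ▸ dvd_zero base)
    subst hd0
    have hy0 : y = 0 := by
      have := hy.symm
      simpa [base_ne_zero] using this
    subst hy0
    exact absurd rfl (h0 (ih hs))

/-- Every property that passes from `x` to `β * x` and holds at `0` and away from the multiples of
`β` holds everywhere. -/
lemma base_induction {P : GaussianInt → Prop} (zero : P 0) (odd : ∀ x, ¬ base ∣ x → P x)
    (shift : ∀ x, x ≠ 0 → P x → P (base * x)) (x : GaussianInt) : P x := by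
  induction hn : x.norm.natAbs using Nat.strong_induction_on generalizing x with
  | _ n ih =>
    by_cases hx : x = 0
    · exact hx ▸ zero
    by_cases hd : base ∣ x
    · obtain ⟨y, rfl⟩ := hd
      have hy : y ≠ 0 := right_ne_zero_of_mul hx
      refine shift y hy (ih _ ?_ y rfl)
      have h2 : (base.norm).natAbs = 2 := by decide
      have hpos : 0 < y.norm.natAbs :=
        Int.natAbs_pos.2 fun h => hy ((GaussianInt.norm_eq_zero).1 h)
      rw [← hn, Zsqrtd.norm_mul, Int.natAbs_mul, h2]
      omega
    · exact odd x hd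

lemma finite_representations (k : ℤ) (x : GaussianInt) : (representations k x).Finite := by
  rcases lt_or_ge k 0 with hk | hk
  · refine Set.Finite.subset Set.finite_empty ?_
    rintro s ⟨-, h⟩
    omega
  obtain ⟨n, rfl⟩ := Int.eq_ofNat_of_zero_le hk
  clear hk
  have h_zero : ∀ k, (representations k 0).Finite := fun k =>
    (Set.finite_singleton []).subset fun s hs => eq_nil_of_isRepresentation_zero hs.1
  have h_shift : ∀ k x, x ≠ 0 → (representations k x).Finite →
      (representations k (base * x)).Finite := by
    intro k x hx h
    rw [representations_base_mul k hx]
    exact h.image _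
  induction n generalizing x with
  | zero =>
    refine base_induction (h_zero _) (fun x hx => ?_) (h_shift _) x
    rw [show ((0 : ℕ) : ℤ) = -1 + 1 by norm_num, representations_of_not_base_dvd _ hx]
    refine Set.Finite.subset Set.finite_empty ?_
    rintro _ ⟨u, -, s, ⟨-, h⟩, -⟩
    omega
  | succ n ih =>
    refine base_induction (h_zero _) (fun x hx => ?_) (h_shift _) x
    rw [Nat.cast_succ, representations_of_not_base_dvd _ hx]
    refine Set.Finite.subset (Set.Finite.biUnion (List.finite_toSet units)
      fun u _ => (ih (divBase (x - u))).image (List.cons u)) ?_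
    rintro s ⟨u, hu, hs⟩
    exact Set.mem_biUnion (x := u) hu hs

lemma count_base_mul (k : ℤ) (x : GaussianInt) : count k (base * x) = count k x := by
  by_cases hx : x = 0
  · rw [hx, mul_zero]
  · rw [count, representations_base_mul k hx,
      Set.ncard_image_of_injective _ (List.cons_injective), count]

lemma count_of_not_base_dvd (k : ℤ) {x : GaussianInt} (hx : ¬ base ∣ x) :
    count k x = (units.map fun u => count (k - 1) (divBase (x - u))).sum := by
  have hdisj : ∀ u v : GaussianInt, u ≠ v → ∀ s t : Set (List GaussianInt),
      Disjoint (List.cons u '' s) (List.cons v '' t) := by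
    intro u v huv s t
    rw [Set.disjoint_left]
    rintro _ ⟨a, -, rfl⟩ ⟨b, -, hb⟩
    exact huv (List.cons.inj hb).1.symm
  have hfin : ∀ u : GaussianInt,
      (List.cons u '' representations (k - 1) (divBase (x - u))).Finite :=
    fun u => (finite_representations _ _).image _
  have h := representations_of_not_base_dvd (k - 1) hx
  rw [sub_add_cancel] at h
  have hset : representations k x =
      List.cons 1 '' representations (k - 1) (divBase (x - 1)) ∪
      (List.cons I '' representations (k - 1) (divBase (x - I)) ∪
      (List.cons (-1) '' representations (k - 1) (divBase (x - -1)) ∪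
      List.cons (-I) '' representations (k - 1) (divBase (x - -I)))) := by
    rw [h]
    ext s
    simp only [units, List.mem_cons, List.not_mem_nil, or_false, Set.mem_ofPred_eq, Set.mem_union,
      exists_eq_or_imp, exists_eq_left]
  rw [count, hset, Set.ncard_union_eq _ (hfin _) (((hfin _).union ((hfin _).union (hfin _)))),
    Set.ncard_union_eq _ (hfin _) ((hfin _).union (hfin _)),
    Set.ncard_union_eq _ (hfin _) (hfin _)]
  · simp only [Set.ncard_image_of_injective _ List.cons_injective, units, List.map_cons,
      List.map_nil, List.sum_cons, List.sum_nil, add_zero, count]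
  · exact hdisj _ _ (by decide) _ _
  · exact Set.disjoint_union_right.2 ⟨hdisj _ _ (by decide) _ _, hdisj _ _ (by decide) _ _⟩
  · exact Set.disjoint_union_right.2 ⟨hdisj _ _ (by decide) _ _,
      Set.disjoint_union_right.2 ⟨hdisj _ _ (by decide) _ _, hdisj _ _ (by decide) _ _⟩⟩

lemma count_zero (k : ℤ) : count k 0 = if k = 0 then 1 else 0 := by
  have h : representations k 0 = if k = 0 then {[]} else ∅ := by
    ext s
    constructor
    · rintro ⟨h, hk⟩
      obtain rfl := eq_nil_of_isRepresentation_zero h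
      have : k = 0 := by simpa [weight] using hk.symm
      simp [this]
    · split_ifs with hk
      · rintro rfl
        exact ⟨isRepresentation_nil.2 rfl, by simp [weight, hk]⟩
      · exact fun h => absurd h (Set.notMem_empty _)
  rw [count, h]
  split_ifs <;> simp

/-! ### Unfolding the low digits -/

/-- The outcomes of peeling off `j` digits from `c + β ^ j * z`, for `z` unspecified: an entry
`(c', m)` stands for a choice of `j` low digits, `m` of them non-zero, after which `z + c'` is left
to be represented. -/
def unfoldings : ℕ → GaussianInt → List (GaussianInt × ℤ)
  | 0, c => [(c, 0)]
  | j + 1, c =>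
    if (c.re + c.im) % 2 = 0 then unfoldings j (divBase c)
    else units.flatMap fun u => (unfoldings j (divBase (c - u))).map fun p => (p.1, p.2 + 1)

lemma count_add_base_pow_mul (j : ℕ) (k : ℤ) (c z : GaussianInt) :
    count k (c + base ^ j * z) =
      ((unfoldings j c).map fun p => count (k - p.2) (z + p.1)).sum := by
  induction j generalizing k c with
  | zero => simp [unfoldings, add_comm]
  | succ j ih =>
    rw [unfoldings]
    split_ifs with hc
    · rw [show c + base ^ (j + 1) * z = base * (divBase c + base ^ j * z) by
        rw [mul_add, base_mul_divBase hc]; ring, count_base_mul, ih]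
    · have hodd : ¬ base ∣ c + base ^ (j + 1) * z := by
        rw [pow_succ', mul_assoc, dvd_add_left (dvd_mul_right _ _), base_dvd_iff]
        exact hc
      rw [count_of_not_base_dvd k hodd, List.map_flatMap, List.flatMap, List.sum_flatten,
        List.map_map]
      congr 1
      refine List.map_congr_left fun u hu => ?_
      have hu' : base * divBase (c - u) = c - u :=
        base_dvd_sub_unit (by rwa [base_dvd_iff]) hu
      have hdiv : divBase (c + base ^ (j + 1) * z - u) = divBase (c - u) + base ^ j * z := by
        rw [show c + base ^ (j + 1) * z - u = base * (divBase (c - u) + base ^ j * z) by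
          rw [mul_add, hu']; ring, divBase_base_mul]
      rw [hdiv, ih, Function.comp_apply, List.map_map]
      congr 1
      refine List.map_congr_left fun p _ => ?_
      simp only [Function.comp_apply]
      congr 1
      ring

/-! ### Non-adjacent forms and minimality of their weight -/

/-- `HasNAFWeight n z` says that `z` has a 3-NAF representation with `n` non-zero digits: a non-zero
digit is put below a 3-NAF only together with two zeros. -/
inductive HasNAFWeight : ℕ → GaussianInt → Prop
  | zero : HasNAFWeight 0 0
  | shift {n : ℕ} {z : GaussianInt} (h : HasNAFWeight n z) : HasNAFWeight n (base * z)
  | cons {n : ℕ} {z v : GaussianInt} (hv : v ∈ units) (h : HasNAFWeight n z) :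
      HasNAFWeight (n + 1) (v + base ^ 3 * z)

/-- The carries: the Gaussian integers of norm at most `5`. -/
def carries : List GaussianInt :=
  [0, 1, I, -1, -I, ⟨1, 1⟩, ⟨1, -1⟩, ⟨-1, 1⟩, ⟨-1, -1⟩, ⟨2, 0⟩, ⟨0, 2⟩, ⟨-2, 0⟩, ⟨0, -2⟩,
    ⟨2, 1⟩, ⟨2, -1⟩, ⟨-2, 1⟩, ⟨-2, -1⟩, ⟨1, 2⟩, ⟨1, -2⟩, ⟨-1, 2⟩, ⟨-1, -2⟩]

/-- A bound for how much adding the carry `c` can lower the weight. -/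
def gain (c : GaussianInt) : ℤ := if c = 0 then 0 else if c.norm ≤ 4 then 1 else 2

lemma count_of_neg {k : ℤ} (hk : k < 0) (x : GaussianInt) : count k x = 0 := by
  have h : representations k x = ∅ := by
    ext s
    refine ⟨?_, fun h => absurd h (Set.notMem_empty _)⟩
    rintro ⟨-, hs⟩
    omega
  rw [count, h, Set.ncard_empty]

/-- The carries stay closed, and the bound `gain` is consistent, when a zero digit is peeled off the
3-NAF. -/
lemma gain_unfoldings_shift : ∀ c ∈ carries, ∀ p ∈ unfoldings 1 c,
    p.1 ∈ carries ∧ gain p.1 ≤ p.2 + gain c := by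
  decide +kernel

/-- The carries stay closed, and the bound `gain` is consistent, when a non-zero digit `v` and the two
zeros above it are peeled off the 3-NAF. -/
lemma gain_unfoldings_cons : ∀ c ∈ carries, ∀ v ∈ units, ∀ p ∈ unfoldings 3 (c + v),
    p.1 ∈ carries ∧ gain p.1 + 1 ≤ p.2 + gain c := by
  decide +kernel

/-- Adding a carry `c` to a number with a 3-NAF of weight `n` lowers the minimal weight by at most
`gain c`.  The carries form a closed system under the peeling off of low digits, so this is an
induction along the 3-NAF.  For `c = 0` it says that 3-NAFs are optimal. -/
theorem HasNAFWeight.count_eq_zero {n : ℕ} {z : GaussianInt} (h : HasNAFWeight n z)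
    {c : GaussianInt} (hc : c ∈ carries) {k : ℤ} (hk : k + gain c < n) : count k (z + c) = 0 := by
  induction h generalizing c k with
  | zero =>
    have hgain : 0 ≤ gain c := by unfold gain; split_ifs <;> norm_num
    exact count_of_neg (by push_cast at hk; omega) _
  | @shift n z h ih =>
    have := count_add_base_pow_mul 1 k c z
    rw [pow_one] at this
    rw [add_comm, this]
    refine List.sum_eq_zero fun x hx => ?_
    obtain ⟨p, hp, rfl⟩ := List.mem_map.1 hx
    obtain ⟨h1, h2⟩ := gain_unfoldings_shift c hc p hp
    exact ih h1 (by omega)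
  | @cons n z v hv h ih =>
    rw [show v + base ^ 3 * z + c = c + v + base ^ 3 * z by ring, count_add_base_pow_mul]
    refine List.sum_eq_zero fun x hx => ?_
    obtain ⟨p, hp, rfl⟩ := List.mem_map.1 hx
    obtain ⟨h1, h2⟩ := gain_unfoldings_cons c hc v hv p hp
    exact ih h1 (by push_cast at hk; omega)

/-- The outcomes of `unfoldings j c` that can contribute to a count of weight `n - m` when `z` has a
3-NAF of weight `n`.  Outcomes outside `carries`, for which `gain` means nothing, are kept. -/
def liveUnfoldings (m : ℤ) (j : ℕ) (c : GaussianInt) : List (GaussianInt × ℤ) :=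
  (unfoldings j c).filter fun p => decide (m + p.2 ≤ gain p.1) || decide (p.1 ∉ carries)

/-- The count of `count_add_base_pow_mul`, without the terms that vanish because the weight left is
too small. -/
lemma HasNAFWeight.count_add_base_pow_mul {n : ℕ} {z : GaussianInt} (h : HasNAFWeight n z) {m : ℤ}
    {j : ℕ} {c : GaussianInt} {l : List (GaussianInt × ℤ)} (hl : (liveUnfoldings m j c).Perm l) :
    count (n - m) (c + base ^ j * z) =
      (l.map fun p => count (n - m - p.2) (z + p.1)).sum := by
  rw [GaussianNAF.count_add_base_pow_mul, ← (hl.map _).sum_eq, liveUnfoldings]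
  induction unfoldings j c with
  | nil => rfl
  | cons p l ih =>
    rw [List.filter_cons]
    split_ifs with hp
    · simp only [List.map_cons, List.sum_cons, ih]
    · rw [List.map_cons, List.sum_cons, ih]
      simp only [Bool.or_eq_true, decide_eq_true_eq, not_or, not_not, not_le] at hp
      rw [h.count_eq_zero hp.2 (by omega), zero_add]

/-! ### The counts near a 3-NAF -/

/-- For `z` with 3-NAF weight `n`: the number of representations of `z + u` of weight `n - 1`. -/
noncomputable def near (n : ℕ) (z u : GaussianInt) : ℕ := count (n - 1) (z + u)

/-- For `z` with 3-NAF weight `n`: the number of representations of `z + u - i * u` of weight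
`n - 1`. -/
noncomputable def diag (n : ℕ) (z u : GaussianInt) : ℕ := count (n - 1) (z + (u - I * u))

section Recursion

variable {n : ℕ} {z u v : GaussianInt}

lemma count_cons (h : HasNAFWeight n z) (hv : v ∈ units) :
    count ((n + 1 : ℕ) : ℤ) (v + base ^ 3 * z) =
      count n z + 2 * near n z v + 2 * near n z (-I * v) + diag n z v := by
  have hl : ∀ v ∈ units, (liveUnfoldings (-1) 3 v).Perm
      [(0, 1), (v, 2), (v, 2), (-I * v, 2), (-I * v, 2), (v - I * v, 2)] := by decide +kernel
  have := h.count_add_base_pow_mul (hl v hv)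
  rw [show ((n + 1 : ℕ) : ℤ) = n - -1 by push_cast; ring, this]
  simp only [List.map_cons, List.map_nil, List.sum_cons, List.sum_nil, near, diag, add_zero]
  ring_nf

lemma near_cons_self (h : HasNAFWeight n z) (hv : v ∈ units) :
    near (n + 1) (v + base ^ 3 * z) v = near n z v + near n z (-I * v) + diag n z v := by
  have hl : ∀ v ∈ units, (liveUnfoldings 0 3 (v + v)).Perm
      [(v, 1), (-I * v, 1), (v - I * v, 1)] := by decide +kernel
  have := h.count_add_base_pow_mul (hl v hv)
  rw [near, show ((n + 1 : ℕ) : ℤ) - 1 = n - 0 by push_cast; ring, add_right_comm, this]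
  simp only [List.map_cons, List.map_nil, List.sum_cons, List.sum_nil, near, diag, add_zero]
  ring_nf

lemma near_cons_I_mul (h : HasNAFWeight n z) (hv : v ∈ units) :
    near (n + 1) (v + base ^ 3 * z) (I * v) = near n z v := by
  have hl : ∀ v ∈ units, (liveUnfoldings 0 3 (v + I * v)).Perm [(v, 1)] := by decide +kernel
  have := h.count_add_base_pow_mul (hl v hv)
  rw [near, show ((n + 1 : ℕ) : ℤ) - 1 = n - 0 by push_cast; ring, add_right_comm, this]
  simp [near]

lemma near_cons_neg (h : HasNAFWeight n z) (hv : v ∈ units) :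
    near (n + 1) (v + base ^ 3 * z) (-v) = count n z := by
  have hl : ∀ v ∈ units, (liveUnfoldings 0 3 (v + -v)).Perm [(0, 0)] := by decide +kernel
  have := h.count_add_base_pow_mul (hl v hv)
  rw [near, show ((n + 1 : ℕ) : ℤ) - 1 = n - 0 by push_cast; ring, add_right_comm, this]
  simp

lemma near_cons_neg_I_mul (h : HasNAFWeight n z) (hv : v ∈ units) :
    near (n + 1) (v + base ^ 3 * z) (-I * v) = near n z (-I * v) := by
  have hl : ∀ v ∈ units, (liveUnfoldings 0 3 (v + -I * v)).Perm [(-I * v, 1)] := by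
    decide +kernel
  have := h.count_add_base_pow_mul (hl v hv)
  rw [near, show ((n + 1 : ℕ) : ℤ) - 1 = n - 0 by push_cast; ring, add_right_comm, this]
  simp [near]

lemma diag_cons_self (h : HasNAFWeight n z) (hv : v ∈ units) :
    diag (n + 1) (v + base ^ 3 * z) v = near n z (-I * v) := by
  have hl : ∀ v ∈ units, (liveUnfoldings 0 3 (v + (v - I * v))).Perm [(-I * v, 1)] := by
    decide +kernel
  have := h.count_add_base_pow_mul (hl v hv)
  rw [diag, show ((n + 1 : ℕ) : ℤ) - 1 = n - 0 by push_cast; ring, add_right_comm, this]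
  simp [near]

lemma diag_cons_I_mul (h : HasNAFWeight n z) (hv : v ∈ units) :
    diag (n + 1) (v + base ^ 3 * z) (I * v) = near n z v := by
  have hl : ∀ v ∈ units, (liveUnfoldings 0 3 (v + (I * v - I * (I * v)))).Perm [(v, 1)] := by
    decide +kernel
  have := h.count_add_base_pow_mul (hl v hv)
  rw [diag, show ((n + 1 : ℕ) : ℤ) - 1 = n - 0 by push_cast; ring, add_right_comm, this]
  simp [near]

lemma diag_cons_neg (h : HasNAFWeight n z) (hv : v ∈ units) :
    diag (n + 1) (v + base ^ 3 * z) (-v) = 0 := by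
  have hl : ∀ v ∈ units, (liveUnfoldings 0 3 (v + (-v - I * -v))).Perm [] := by
    decide +kernel
  have := h.count_add_base_pow_mul (hl v hv)
  rw [diag, show ((n + 1 : ℕ) : ℤ) - 1 = n - 0 by push_cast; ring, add_right_comm, this]
  simp

lemma diag_cons_neg_I_mul (h : HasNAFWeight n z) (hv : v ∈ units) :
    diag (n + 1) (v + base ^ 3 * z) (-I * v) = 0 := by
  have hl : ∀ v ∈ units, (liveUnfoldings 0 3 (v + (-I * v - I * (-I * v)))).Perm [] := by
    decide +kernel
  have := h.count_add_base_pow_mul (hl v hv)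
  rw [diag, show ((n + 1 : ℕ) : ℤ) - 1 = n - 0 by push_cast; ring, add_right_comm, this]
  simp

lemma near_shift (h : HasNAFWeight n z) (hu : u ∈ units) : near n (base * z) u = 0 := by
  have hl : ∀ u ∈ units, (liveUnfoldings 1 1 u).Perm [] := by decide +kernel
  have := h.count_add_base_pow_mul (hl u hu)
  rw [pow_one] at this
  rw [near, add_comm, this]
  simp

lemma diag_shift (h : HasNAFWeight n z) (hu : u ∈ units) :
    diag n (base * z) u = near n z (-u) := by
  have hl : ∀ u ∈ units, (liveUnfoldings 1 1 (u - I * u)).Perm [(-u, 0)] := by decide +kernel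
  have := h.count_add_base_pow_mul (hl u hu)
  rw [pow_one] at this
  rw [diag, add_comm, this]
  simp [near]

lemma near_zero (u : GaussianInt) : near 0 0 u = 0 := count_of_neg (by norm_num) _

lemma diag_zero (u : GaussianInt) : diag 0 0 u = 0 := count_of_neg (by norm_num) _

end Recursion

/-- How the counts that enter with the next digit `u` arise when the digit before it is `v`. -/
lemma near_cons_cases {n : ℕ} {z u v : GaussianInt} (h : HasNAFWeight n z) (hv : v ∈ units)
    (hu : u ∈ units) :
    (u = v ∧ near (n + 1) (v + base ^ 3 * z) u = near n z v + near n z (-I * v) + diag n z v ∧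
      near (n + 1) (v + base ^ 3 * z) (-I * u) = near n z (-I * v) ∧
      diag (n + 1) (v + base ^ 3 * z) u = near n z (-I * v)) ∨
    (u = I * v ∧ near (n + 1) (v + base ^ 3 * z) u = near n z v ∧
      near (n + 1) (v + base ^ 3 * z) (-I * u) =
        near n z v + near n z (-I * v) + diag n z v ∧
      diag (n + 1) (v + base ^ 3 * z) u = near n z v) ∨
    (u = -v ∧ near (n + 1) (v + base ^ 3 * z) u = count n z ∧
      near (n + 1) (v + base ^ 3 * z) (-I * u) = near n z v ∧
      diag (n + 1) (v + base ^ 3 * z) u = 0) ∨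
    (u = -I * v ∧ near (n + 1) (v + base ^ 3 * z) u = near n z (-I * v) ∧
      near (n + 1) (v + base ^ 3 * z) (-I * u) = count n z ∧
      diag (n + 1) (v + base ^ 3 * z) u = 0) := by
  have hcases : ∀ v ∈ units, ∀ u ∈ units, u = v ∨ u = I * v ∨ u = -v ∨ u = -I * v := by decide
  have h1 : -I * (I * v) = v := by
    rw [← mul_assoc, show -I * I = 1 by decide, one_mul]
  have h2 : -I * -v = I * v := by ring
  have h3 : -I * (-I * v) = -v := by
    rw [← mul_assoc, show -I * -I = -1 by decide, neg_one_mul]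
  rcases hcases v hv u hu with rfl | rfl | rfl | rfl
  · exact Or.inl ⟨rfl, near_cons_self h hv, near_cons_neg_I_mul h hv, diag_cons_self h hv⟩
  · refine Or.inr (Or.inl ⟨rfl, near_cons_I_mul h hv, ?_, diag_cons_I_mul h hv⟩)
    rw [h1, near_cons_self h hv]
  · refine Or.inr (Or.inr (Or.inl ⟨rfl, near_cons_neg h hv, ?_, diag_cons_neg h hv⟩))
    rw [h2, near_cons_I_mul h hv]
  · refine Or.inr (Or.inr (Or.inr
      ⟨rfl, near_cons_neg_I_mul h hv, ?_, diag_cons_neg_I_mul h hv⟩))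
    rw [h3, near_cons_neg h hv]

/-! ### The sequence of bounds -/

lemma r_add_three {n : ℕ} (hn : 2 ≤ n) : r (n + 3) = r (n + 2) + 2 * r (n + 1) + 2 * r n := by
  obtain ⟨m, rfl⟩ := Nat.exists_eq_add_of_le' hn
  rfl

lemma le_r_add_three (n : ℕ) : r (n + 2) + 2 * r (n + 1) + 2 * r n ≤ r (n + 3) := by
  rcases lt_or_ge n 2 with hn | hn
  · interval_cases n <;> decide
  · exact (r_add_three hn).ge

lemma r_pos (n : ℕ) : 0 < r n := by
  induction n using Nat.strong_induction_on with
  | _ n ih =>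
    rcases lt_or_ge n 3 with hn | hn
    · interval_cases n <;> decide
    · obtain ⟨m, rfl⟩ := Nat.exists_eq_add_of_le' hn
      have := le_r_add_three m
      have := ih m (by omega)
      omega

lemma r_lt_succ {n : ℕ} (hn : 1 ≤ n) : r n < r (n + 1) := by
  rcases lt_or_ge n 2 with h | h
  · interval_cases n; decide
  · obtain ⟨m, rfl⟩ := Nat.exists_eq_add_of_le' h
    have : r (m + 2) + 2 * r (m + 1) + 2 * r m ≤ r (m + 2 + 1) := le_r_add_three m
    have := r_pos m
    omega

lemma two_mul_r_add_lt {n : ℕ} (hn : 2 ≤ n) : 2 * r (n + 2) + r n < r (n + 3) := by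
  rcases lt_or_ge n 4 with h | h
  · interval_cases n <;> decide
  · obtain ⟨m, rfl⟩ := Nat.exists_eq_add_of_le' h
    have h1 := r_add_three (n := m + 2) (by omega)
    have h2 := r_add_three (n := m + 3) (by omega)
    have h3 := r_add_three (n := m + 4) (by omega)
    have := r_pos (m + 2)
    simp only [add_assoc, Nat.reduceAdd] at *
    omega

lemma two_mul_r_add_le (n : ℕ) : 2 * r (n + 2) + r n ≤ r (n + 3) := by
  rcases lt_or_ge n 2 with h | h
  · interval_cases n <;> decide
  · exact (two_mul_r_add_lt h).le

lemma three_mul_r_add_lt {n : ℕ} (hn : 2 ≤ n) : 3 * r (n + 2) + 7 * r n < 2 * r (n + 3) := by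
  rcases lt_or_ge n 5 with h | h
  · interval_cases n <;> decide
  · obtain ⟨m, rfl⟩ := Nat.exists_eq_add_of_le' h
    have h0 := r_add_three (n := m + 2) (by omega)
    have h1 := r_add_three (n := m + 3) (by omega)
    have h2 := r_add_three (n := m + 4) (by omega)
    have h3 := r_add_three (n := m + 5) (by omega)
    have h4 := le_r_add_three (m + 1)
    have := r_pos (m + 3)
    simp only [add_assoc, Nat.reduceAdd] at *
    omega

lemma three_mul_r_add_le (n : ℕ) : 3 * r (n + 2) + 7 * r n ≤ 2 * r (n + 3) := by
  rcases lt_or_ge n 2 with h | h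
  · interval_cases n <;> decide
  · exact (three_mul_r_add_lt h).le

/-! ### The upper bound -/

/-- The inequalities that are carried along a 3-NAF of weight `n`.  Here `f` counts optimal
representations and `a`, `b`, `e` are the neighbouring counts that enter when the next digit is put
down. -/
structure Bounds (n f a b e : ℕ) : Prop where
  /-- The bound on the number of optimal representations. -/
  le : f ≤ r n
  /-- The bound after one more digit. -/
  next : f + 2 * a + 2 * b + e ≤ r (n + 1)
  /-- The bound after two more digits `u`, `u`. -/
  same : f + 4 * a + 7 * b + 3 * e ≤ r (n + 2)
  /-- The bound after two more digits `u`, `i * u`. -/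
  same' : f + 7 * a + 4 * b + 3 * e ≤ r (n + 2)
  /-- The bound after two more digits `u`, `-u`. -/
  turn : 3 * f + 4 * a + 2 * b + e ≤ r (n + 2)
  /-- The bound after two more digits `u`, `-i * u`. -/
  turn' : 3 * f + 2 * a + 4 * b + e ≤ r (n + 2)
  /-- The neighbouring count in the direction `u` after one more digit `u` is at most `f`. -/
  sum : a + b + e ≤ f

lemma Bounds.swap {n f a b e : ℕ} (h : Bounds n f a b e) : Bounds n f b a e where
  le := h.le
  next := by have := h.next; omega
  same := by have := h.same'; omega
  same' := by have := h.same; omega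
  turn := by have := h.turn'; omega
  turn' := by have := h.turn; omega
  sum := by have := h.sum; omega

/-- The bounds pass to the next digit `v` and the direction `u = v`; by symmetry this also covers
`u = i * v`. -/
lemma Bounds.repeat {n f a b e : ℕ} (h : Bounds n f a b e) :
    Bounds (n + 1) (f + 2 * a + 2 * b + e) (a + b + e) b b := by
  obtain ⟨h0, h1, h2, h2', h3, h3', hs⟩ := h
  have r1 := le_r_add_three n
  have r2 := two_mul_r_add_le n
  constructor <;> simp only [add_assoc, Nat.reduceAdd] at * <;> omega

/-- The bounds pass to the next digit `v` and the direction `u = -v`; by symmetry this also covers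
`u = -i * v`. -/
lemma Bounds.reverse {n f a b e : ℕ} (h : Bounds n f a b e) :
    Bounds (n + 1) (f + 2 * a + 2 * b + e) f a 0 := by
  obtain ⟨h0, h1, h2, h2', h3, h3', hs⟩ := h
  have r1 := le_r_add_three n
  have r2 := three_mul_r_add_le n
  constructor <;> simp only [add_assoc, Nat.reduceAdd] at * <;> omega

/-- The bounds survive the insertion of a zero digit. -/
lemma Bounds.shift {n f a b e : ℕ} (h : Bounds n f a b e) : Bounds n f 0 0 a := by
  obtain ⟨h0, h1, h2, h2', h3, h3', hs⟩ := h
  constructor <;> omega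

lemma neg_I_mul_mem_units {u : GaussianInt} (hu : u ∈ units) : -I * u ∈ units := by
  revert u; decide

lemma neg_mem_units {u : GaussianInt} (hu : u ∈ units) : -u ∈ units := by
  revert u; decide

/-- The upper bound: a number of 3-NAF weight `n` has at most `r n` representations of weight `n`.
The other inequalities in `Bounds` are what makes the induction close. -/
theorem HasNAFWeight.bounds {n : ℕ} {z : GaussianInt} (h : HasNAFWeight n z) :
    ∀ u ∈ units, Bounds n (count n z) (near n z u) (near n z (-I * u)) (diag n z u) := by
  induction h with
  | zero =>
    intro u _
    rw [near_zero, near_zero, diag_zero, Nat.cast_zero, count_zero, if_pos rfl]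
    constructor <;> decide
  | @shift n z h ih =>
    intro u hu
    rw [near_shift h hu, near_shift h (neg_I_mul_mem_units hu), diag_shift h hu, count_base_mul]
    exact (ih (-u) (neg_mem_units hu)).shift
  | @cons n z v hv h ih =>
    intro u hu
    have hb := ih v hv
    rw [count_cons h hv]
    rcases near_cons_cases h hv hu with ⟨-, h1, h2, h3⟩ | ⟨-, h1, h2, h3⟩ | ⟨-, h1, h2, h3⟩ |
      ⟨-, h1, h2, h3⟩ <;> rw [h1, h2, h3]
    · exact hb.repeat
    · have := hb.swap.repeat.swap
      convert this using 1 <;> ring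
    · exact hb.reverse
    · have := hb.swap.reverse.swap
      convert this using 1
      ring

lemma HasNAFWeight.near_le {n : ℕ} {z u : GaussianInt} (h : HasNAFWeight (n + 1) z)
    (hu : u ∈ units) : near (n + 1) z u ≤ r n := by
  generalize hm : n + 1 = m at h
  cases h with
  | zero => omega
  | shift h => rw [near_shift h hu]; exact Nat.zero_le _
  | @cons n' z v hv h =>
    obtain rfl : n = n' := by omega
    have h0 := (h.bounds v hv).le
    have hs := (h.bounds v hv).sum
    rcases near_cons_cases h hv hu with ⟨-, h1, -⟩ | ⟨-, h1, -⟩ | ⟨-, h1, -⟩ |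
      ⟨-, h1, -⟩ <;> omega

/-! ### Numbers that attain the bound -/

/-- From weight `3` on, the bound on the number of optimal representations cannot be attained by
going on with a digit `u` and then with `u` or `i * u`. -/
lemma HasNAFWeight.same_lt {n : ℕ} {z : GaussianInt} (h : HasNAFWeight n z) (hn : 3 ≤ n) :
    ∀ u ∈ units,
      count n z + 4 * near n z u + 7 * near n z (-I * u) + 3 * diag n z u < r (n + 2) ∧
      count n z + 7 * near n z u + 4 * near n z (-I * u) + 3 * diag n z u < r (n + 2) := by
  induction h with
  | zero => omega
  | @shift n z h ih =>
    intro u hu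
    rw [near_shift h hu, near_shift h (neg_I_mul_mem_units hu), diag_shift h hu, count_base_mul]
    have := ih hn (-u) (neg_mem_units hu)
    omega
  | @cons n z v hv h _ =>
    intro u hu
    obtain ⟨h0, h1, h2, h2', h3, h3', hs⟩ := h.bounds v hv
    have r1 := le_r_add_three n
    have r2 := two_mul_r_add_lt (n := n) (by omega)
    have r3 := three_mul_r_add_lt (n := n) (by omega)
    have r4 := r_pos n
    rw [count_cons h hv]
    simp only [add_assoc, Nat.reduceAdd] at *
    rcases near_cons_cases h hv hu with ⟨-, e1, e2, e3⟩ | ⟨-, e1, e2, e3⟩ | ⟨-, e1, e2, e3⟩ |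
      ⟨-, e1, e2, e3⟩ <;> rw [e1, e2, e3] <;> omega

/-- A number that attains the bound has no gap wider than two zeros below its second lowest non-zero
digit. -/
lemma HasNAFWeight.exists_cons {n : ℕ} {z u : GaussianInt} (h : HasNAFWeight n z) (hn : 1 ≤ n)
    (hu : u ∈ units) (heq : count ((n + 1 : ℕ) : ℤ) (u + base ^ 3 * z) = r (n + 1)) :
    ∃ m, n = m + 1 ∧ ∃ y w, w ∈ units ∧ HasNAFWeight m y ∧ z = w + base ^ 3 * y := by
  rw [count_cons h hu] at heq
  cases h with
  | zero => omega
  | @shift n z h =>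
    rw [near_shift h hu, near_shift h (neg_I_mul_mem_units hu), diag_shift h hu,
      count_base_mul] at heq
    have h1 := (h.bounds _ (neg_mem_units hu)).next
    have h0 := (h.bounds _ (neg_mem_units hu)).le
    have := r_lt_succ hn
    omega
  | @cons m y w hw h => exact ⟨m, rfl, y, w, hw, h, rfl⟩

/-- If a weight of at least `5` attains the bound, then the lowest digit `u` is `-w` or `-i * w`,
where `w` is the next non-zero digit, and all counts that enter are as large as possible. -/
lemma HasNAFWeight.extremal_cons {m : ℕ} {y w u : GaussianInt} (h : HasNAFWeight (m + 3) y)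
    (hw : w ∈ units) (hu : u ∈ units)
    (heq : count ((m + 3 + 1 + 1 : ℕ) : ℤ) (u + base ^ 3 * (w + base ^ 3 * y)) = r (m + 5)) :
    count ((m + 3 + 1 : ℕ) : ℤ) (w + base ^ 3 * y) = r (m + 4) ∧
      count ((m + 3 : ℕ) : ℤ) y = r (m + 3) ∧
      ((u = -w ∧ near (m + 3) y w = r (m + 2)) ∨
        (u = -I * w ∧ near (m + 3) y (-I * w) = r (m + 2))) := by
  have hs := h.same_lt (by omega) w hw
  have ha := h.near_le hw
  have hb := h.near_le (neg_I_mul_mem_units hw)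
  obtain ⟨h0, h1, -⟩ := h.bounds w hw
  have hr := r_add_three (n := m + 2) (by omega)
  rw [count_cons (h.cons hw) hu, count_cons h hw] at heq
  rw [count_cons h hw]
  simp only [add_assoc, Nat.reduceAdd] at *
  rcases near_cons_cases h hw hu with ⟨hu, e1, e2, e3⟩ | ⟨hu, e1, e2, e3⟩ | ⟨hu, e1, e2, e3⟩ |
    ⟨hu, e1, e2, e3⟩ <;> simp only [add_assoc, Nat.reduceAdd] at *
  · omega
  · omega
  · exact ⟨by omega, by omega, Or.inl ⟨hu, by omega⟩⟩
  · exact ⟨by omega, by omega, Or.inr ⟨hu, by omega⟩⟩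

/-- The digit `-w` attains the bound after `w` if the count at the carry `w` is as large as possible.
-/
lemma HasNAFWeight.count_cons_neg {m : ℕ} {y w : GaussianInt} (h : HasNAFWeight (m + 3) y)
    (hw : w ∈ units) (h1 : count ((m + 3 + 1 : ℕ) : ℤ) (w + base ^ 3 * y) = r (m + 4))
    (h0 : count ((m + 3 : ℕ) : ℤ) y = r (m + 3)) (ha : near (m + 3) y w = r (m + 2)) :
    count ((m + 3 + 1 + 1 : ℕ) : ℤ) (-w + base ^ 3 * (w + base ^ 3 * y)) = r (m + 5) := by
  have hr := r_add_three (n := m + 2) (by omega)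
  have hu := neg_mem_units hw
  have h2 : -I * -w = I * w := by ring
  rw [count_cons (h.cons hw) hu, h1, near_cons_neg h hw, diag_cons_neg h hw, h2,
    near_cons_I_mul h hw, h0, ha]
  simp only [add_assoc, Nat.reduceAdd] at *
  omega

/-- The digit `-i * w` attains the bound after `w` if the count at the carry `-i * w` is as large as
possible. -/
lemma HasNAFWeight.count_cons_neg_I_mul {m : ℕ} {y w : GaussianInt} (h : HasNAFWeight (m + 3) y)
    (hw : w ∈ units) (h1 : count ((m + 3 + 1 : ℕ) : ℤ) (w + base ^ 3 * y) = r (m + 4))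
    (h0 : count ((m + 3 : ℕ) : ℤ) y = r (m + 3)) (hb : near (m + 3) y (-I * w) = r (m + 2)) :
    count ((m + 3 + 1 + 1 : ℕ) : ℤ) (-I * w + base ^ 3 * (w + base ^ 3 * y)) = r (m + 5) := by
  have hr := r_add_three (n := m + 2) (by omega)
  have hu := neg_I_mul_mem_units hw
  have h2 : -I * (-I * w) = -w := by
    rw [← mul_assoc, show -I * -I = -1 by decide, neg_one_mul]
  rw [count_cons (h.cons hw) hu, h1, near_cons_neg_I_mul h hw, diag_cons_neg_I_mul h hw, h2,
    near_cons_neg h hw, h0, hb]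
  simp only [add_assoc, Nat.reduceAdd] at *
  omega

/-! ### Weight four -/

/-- A container for the counts `count n z`, `near n z` and `diag n z`, to compute with. -/
structure Profile where
  /-- The value of `count n z`. -/
  count : ℕ
  /-- The values of `near n z` on units. -/
  near : GaussianInt → ℕ
  /-- The values of `diag n z` on units. -/
  diag : GaussianInt → ℕ

/-- The profile of `v + β ^ 3 * z`, computed from that of `z`. -/
def Profile.cons (v : GaussianInt) (p : Profile) : Profile where
  count := p.count + 2 * p.near v + 2 * p.near (-I * v) + p.diag v
  near u := if u = v then p.near v + p.near (-I * v) + p.diag v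
    else if u = I * v then p.near v else if u = -v then p.count else p.near (-I * v)
  diag u := if u = v then p.near (-I * v) else if u = I * v then p.near v else 0

/-- `p` holds the counts of `z`, which has 3-NAF weight `n`. -/
structure Profile.IsProfile (p : Profile) (n : ℕ) (z : GaussianInt) : Prop where
  hasNAFWeight : HasNAFWeight n z
  count_eq : GaussianNAF.count n z = p.count
  near_eq : ∀ u ∈ units, GaussianNAF.near n z u = p.near u
  diag_eq : ∀ u ∈ units, GaussianNAF.diag n z u = p.diag u

/-- The profile of `0`. -/
def Profile.zero : Profile := ⟨1, fun _ => 0, fun _ => 0⟩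

lemma Profile.isProfile_zero : Profile.zero.IsProfile 0 0 where
  hasNAFWeight := .zero
  count_eq := by rw [Nat.cast_zero, count_zero, if_pos rfl, zero]
  near_eq u _ := near_zero u
  diag_eq u _ := diag_zero u

lemma Profile.IsProfile.cons {p : Profile} {n : ℕ} {z v : GaussianInt} (h : p.IsProfile n z)
    (hv : v ∈ units) : (p.cons v).IsProfile (n + 1) (v + base ^ 3 * z) := by
  have hne : ∀ v ∈ units, I * v ≠ v ∧ -v ≠ v ∧ -v ≠ I * v ∧ -I * v ≠ v ∧ -I * v ≠ I * v ∧
      -I * v ≠ -v := by decide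
  obtain ⟨n1, n2, n3, n4, n5, n6⟩ := hne v hv
  have ha := h.near_eq v hv
  have hb := h.near_eq _ (neg_I_mul_mem_units hv)
  have he := h.diag_eq v hv
  have hf := h.count_eq
  refine ⟨h.hasNAFWeight.cons hv, ?_, ?_, ?_⟩
  · rw [count_cons h.hasNAFWeight hv, ha, hb, he, hf, Profile.cons]
  · intro u hu
    rcases near_cons_cases h.hasNAFWeight hv hu with ⟨rfl, e, -⟩ | ⟨rfl, e, -⟩ | ⟨rfl, e, -⟩ |
      ⟨rfl, e, -⟩ <;> rw [e] <;> simp only [Profile.cons, if_pos, if_neg, *, not_false_eq_true]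
  · intro u hu
    rcases near_cons_cases h.hasNAFWeight hv hu with ⟨rfl, -, -, e⟩ | ⟨rfl, -, -, e⟩ |
      ⟨rfl, -, -, e⟩ | ⟨rfl, -, -, e⟩ <;> rw [e] <;>
      simp only [Profile.cons, if_pos, if_neg, *, not_false_eq_true]

/-- The number whose four non-zero 3-NAF digits are, from the highest to the lowest, `q`, `t`, `w`,
`v`, with two zeros between consecutive ones. -/
def word (q t w v : GaussianInt) : GaussianInt :=
  v + base ^ 3 * (w + base ^ 3 * (t + base ^ 3 * (q + base ^ 3 * 0)))

lemma isProfile_word {q t w : GaussianInt} (hq : q ∈ units) (ht : t ∈ units) (hw : w ∈ units) :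
    (((Profile.zero.cons q).cons t).cons w).IsProfile 3
      (w + base ^ 3 * (t + base ^ 3 * (q + base ^ 3 * 0))) :=
  ((Profile.isProfile_zero.cons hq).cons ht).cons hw

lemma HasNAFWeight.eq_zero {z : GaussianInt} (h : HasNAFWeight 0 z) : z = 0 := by
  generalize hm : 0 = m at h
  induction h with
  | zero => rfl
  | shift h ih => rw [ih hm, mul_zero]
  | cons => omega

/-- A number of weight `4` that attains the bound `17` has no gaps wider than two zeros. -/
lemma HasNAFWeight.exists_word {z v : GaussianInt} (h : HasNAFWeight 3 z) (hv : v ∈ units)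
    (heq : count ((3 + 1 : ℕ) : ℤ) (v + base ^ 3 * z) = 17) :
    ∃ q ∈ units, ∃ t ∈ units, ∃ w ∈ units,
      z = w + base ^ 3 * (t + base ^ 3 * (q + base ^ 3 * 0)) := by
  obtain ⟨m, hm, y, w, hw, hy, rfl⟩ := h.exists_cons (by norm_num) hv heq
  obtain rfl : m = 2 := by omega
  rw [count_cons h hv, count_cons hy hw] at heq
  -- The digits `v = w` and `v = i * w` are the only ones with which `17` is possible.
  have hsame :
      count (2 : ℕ) y + 4 * near 2 y w + 7 * near 2 y (-I * w) + 3 * diag 2 y w = 17 ∨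
      count (2 : ℕ) y + 7 * near 2 y w + 4 * near 2 y (-I * w) + 3 * diag 2 y w = 17 := by
    have ha := hy.near_le hw
    have hb := hy.near_le (neg_I_mul_mem_units hw)
    obtain ⟨h0, h1, -⟩ := hy.bounds w hw
    rw [show r 1 = 1 from rfl] at ha hb
    rw [show r 2 = 3 from rfl] at h0
    rw [show r (2 + 1) = 8 from rfl] at h1
    rcases near_cons_cases hy hw hv with ⟨-, e1, e2, e3⟩ | ⟨-, e1, e2, e3⟩ | ⟨-, e1, e2, e3⟩ |
      ⟨-, e1, e2, e3⟩ <;> rw [e1, e2, e3] at heq <;> omega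
  clear heq h hm
  generalize hm : 2 = m at hy hsame
  cases hy with
  | zero => omega
  | @shift n y hy =>
    rw [near_shift hy hw, near_shift hy (neg_I_mul_mem_units hw), diag_shift hy hw,
      count_base_mul] at hsame
    have h0 := (hy.bounds _ (neg_mem_units hw)).le
    have hs := (hy.bounds _ (neg_mem_units hw)).sum
    subst hm
    rw [show r 2 = 3 from rfl] at h0
    omega
  | @cons n y t ht hy =>
    obtain rfl : n = 1 := by omega
    clear hm
    rw [count_cons hy ht] at hsame
    have hcases := near_cons_cases hy ht hw
    generalize hm : 1 = m at hy hsame hcases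
    cases hy with
    | zero => omega
    | @shift n y hy =>
      rw [near_shift hy ht, near_shift hy (neg_I_mul_mem_units ht), diag_shift hy ht,
        count_base_mul] at hsame hcases
      have h0 := (hy.bounds _ (neg_mem_units ht)).le
      have hs := (hy.bounds _ (neg_mem_units ht)).sum
      subst hm
      rw [show r 1 = 1 from rfl] at h0
      rcases hcases with ⟨-, e1, e2, e3⟩ | ⟨-, e1, e2, e3⟩ | ⟨-, e1, e2, e3⟩ |
        ⟨-, e1, e2, e3⟩ <;> rw [e1, e2, e3] at hsame <;> omega
    | @cons n y q hq hy =>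
      obtain rfl : n = 0 := by omega
      obtain rfl := hy.eq_zero
      exact ⟨q, hq, t, ht, w, hw, rfl⟩

/-! ### Counting the extremal numbers -/

/-- The numbers outside `β ℤ[i]` of 3-NAF weight `n` that attain the bound `r n`. -/
def extremal (n : ℕ) : Set GaussianInt :=
  {x | ¬ base ∣ x ∧ HasNAFWeight n x ∧ count n x = r n}

lemma not_base_dvd_cons {v z : GaussianInt} (hv : v ∈ units) : ¬ base ∣ v + base ^ 3 * z := by
  rw [dvd_add_left (Dvd.dvd.mul_right (dvd_pow_self _ (by norm_num)) _)]
  exact not_base_dvd_of_mem_units hv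

lemma cons_inj {v v' z z' : GaussianInt} (hv : v ∈ units) (hv' : v' ∈ units)
    (h : v + base ^ 3 * z = v' + base ^ 3 * z') : v = v' ∧ z = z' := by
  have hd : base ^ 3 * (z' - z) = v - v' := by linear_combination -h
  have hn := congrArg Zsqrtd.norm hd
  rw [Zsqrtd.norm_mul, show (base ^ 3).norm = 8 by decide] at hn
  have hmod : ∀ v ∈ units, ∀ v' ∈ units, (v - v').norm % 8 = 0 → v = v' := by decide
  obtain rfl := hmod v hv v' hv' (by omega)
  refine ⟨rfl, ?_⟩
  rw [sub_self] at hd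
  have := (mul_eq_zero.1 hd).resolve_left (pow_ne_zero _ base_ne_zero)
  exact (sub_eq_zero.1 this).symm

lemma exists_cons_of_mem_extremal {n : ℕ} {x : GaussianInt} (h : x ∈ extremal (n + 1)) :
    ∃ v ∈ units, ∃ z, HasNAFWeight n z ∧ x = v + base ^ 3 * z := by
  obtain ⟨hx, hn, -⟩ := h
  generalize hm : n + 1 = m at hn
  cases hn with
  | zero => omega
  | shift h => exact absurd (dvd_mul_right _ _) hx
  | @cons n' z v hv h =>
    obtain rfl : n = n' := by omega
    exact ⟨v, hv, z, h, rfl⟩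

/-- In an extremal number of weight at least `4`, the part above the lowest digit `w` has as many
optimal representations as possible, and so has one of the two numbers that arise by a carry in the
directions `w` and `-i * w`. -/
lemma exists_near_eq {m : ℕ} {x : GaussianInt} (h : x ∈ extremal (m + 4)) :
    ∃ w ∈ units, ∃ y, HasNAFWeight (m + 3) y ∧ x = w + base ^ 3 * y ∧
      count ((m + 3 : ℕ) : ℤ) y = r (m + 3) ∧
      (near (m + 3) y w = r (m + 2) ∨ near (m + 3) y (-I * w) = r (m + 2)) := by
  obtain ⟨w, hw, y, hy, rfl⟩ := exists_cons_of_mem_extremal h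
  refine ⟨w, hw, y, hy, rfl, ?_⟩
  have heq := h.2.2
  cases m with
  | zero =>
    obtain ⟨q, hq, t, ht, s, hs, rfl⟩ := hy.exists_word hw heq
    have hp := isProfile_word hq ht hs
    have key : ∀ q ∈ units, ∀ t ∈ units, ∀ s ∈ units, ∀ w ∈ units,
        ((((Profile.zero.cons q).cons t).cons s).cons w).count = 17 →
        (((Profile.zero.cons q).cons t).cons s).count = 8 ∧
        ((((Profile.zero.cons q).cons t).cons s).near w = 3 ∨
          (((Profile.zero.cons q).cons t).cons s).near (-I * w) = 3) := by decide +kernel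
    have := key q hq t ht s hs w hw ((hp.cons hw).count_eq ▸ heq)
    rw [← hp.count_eq, ← hp.near_eq _ hw, ← hp.near_eq _ (neg_I_mul_mem_units hw)] at this
    exact this
  | succ m =>
    obtain ⟨k, hk, q, t, ht, hq, rfl⟩ := hy.exists_cons (by omega) hw heq
    obtain rfl : k = m + 3 := by omega
    obtain ⟨h1, h0, h⟩ := hq.extremal_cons ht hw heq
    refine ⟨h1, ?_⟩
    rcases h with ⟨rfl, -⟩ | ⟨rfl, -⟩
    · exact Or.inl ((near_cons_neg hq ht).trans h0)
    · right
      rw [← mul_assoc, show -I * -I = -1 by decide, neg_one_mul]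
      exact (near_cons_neg hq ht).trans h0

/-- Every extremal number of weight at least `4` is continued to lower digits by exactly one
extremal number of the next weight. -/
lemma existsUnique_cons_mem_extremal {m : ℕ} {z : GaussianInt} (h : z ∈ extremal (m + 4)) :
    ∃ v ∈ units, v + base ^ 3 * z ∈ extremal (m + 5) ∧
      ∀ u ∈ units, u + base ^ 3 * z ∈ extremal (m + 5) → u = v := by
  obtain ⟨w, hw, y, hy, rfl, h0, hab⟩ := exists_near_eq h
  have h1 := h.2.2
  have hnot : ¬ (near (m + 3) y w = r (m + 2) ∧ near (m + 3) y (-I * w) = r (m + 2)) := by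
    rintro ⟨ha, hb⟩
    have hn := (hy.bounds w hw).next
    have hr : 4 * r (m + 2) + r (m + 3) > r (m + 4) := by
      rcases m with - | m
      · decide
      · have := r_add_three (n := m + 2) (by omega)
        have := r_lt_succ (n := m + 2) (by omega)
        have := r_pos (m + 3)
        simp only [add_assoc, Nat.reduceAdd] at *
        omega
    simp only [add_assoc, Nat.reduceAdd] at *
    omega
  have huniq : ∀ u ∈ units, u + base ^ 3 * (w + base ^ 3 * y) ∈ extremal (m + 5) →
      (u = -w ∧ near (m + 3) y w = r (m + 2)) ∨
        (u = -I * w ∧ near (m + 3) y (-I * w) = r (m + 2)) :=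
    fun u hu hmem => (hy.extremal_cons hw hu hmem.2.2).2.2
  rcases hab with ha | hb
  · refine ⟨-w, neg_mem_units hw, ⟨not_base_dvd_cons (neg_mem_units hw),
      (hy.cons hw).cons (neg_mem_units hw), hy.count_cons_neg hw h1 h0 ha⟩, fun u hu hmem => ?_⟩
    rcases huniq u hu hmem with ⟨hu, -⟩ | ⟨-, hb⟩
    · exact hu
    · exact absurd ⟨ha, hb⟩ hnot
  · refine ⟨-I * w, neg_I_mul_mem_units hw, ⟨not_base_dvd_cons (neg_I_mul_mem_units hw),
      (hy.cons hw).cons (neg_I_mul_mem_units hw), hy.count_cons_neg_I_mul hw h1 h0 hb⟩,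
      fun u hu hmem => ?_⟩
    rcases huniq u hu hmem with ⟨-, ha⟩ | ⟨hu, -⟩
    · exact absurd ⟨ha, hb⟩ hnot
    · exact hu

lemma encard_extremal_succ (m : ℕ) : (extremal (m + 5)).encard = (extremal (m + 4)).encard := by
  choose! f hf hmem huniq using fun (z : GaussianInt) (h : z ∈ extremal (m + 4)) =>
    existsUnique_cons_mem_extremal h
  have himage : extremal (m + 5) = (fun z => f z + base ^ 3 * z) '' extremal (m + 4) := by
    ext x
    constructor
    · intro hx
      obtain ⟨v, hv, z, hz, rfl⟩ := exists_cons_of_mem_extremal hx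
      obtain ⟨k, hk, y, w, hw, hy, rfl⟩ := hz.exists_cons (by omega) hv hx.2.2
      obtain rfl : k = m + 3 := by omega
      have hz' : w + base ^ 3 * y ∈ extremal (m + 4) :=
        ⟨not_base_dvd_cons hw, hz, (hy.extremal_cons hw hv hx.2.2).1⟩
      exact ⟨_, hz', by rw [huniq _ hz' v hv hx]⟩
    · rintro ⟨z, hz, rfl⟩
      exact hmem z hz
  rw [himage]
  refine Set.InjOn.encard_image fun z hz z' hz' h => ?_
  exact (cons_inj (hf z hz) (hf z' hz') h).2

lemma encard_extremal_four : (extremal 4).encard = 16 := by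
  let D : Finset (GaussianInt × GaussianInt × GaussianInt × GaussianInt) :=
    (units.toFinset ×ˢ units.toFinset ×ˢ units.toFinset ×ˢ units.toFinset).filter fun p =>
      ((((Profile.zero.cons p.1).cons p.2.1).cons p.2.2.1).cons p.2.2.2).count = 17
  have hD : D.card = 16 := by decide +kernel
  have hmem : ∀ p, p ∈ D ↔ (p.1 ∈ units ∧ p.2.1 ∈ units ∧ p.2.2.1 ∈ units ∧ p.2.2.2 ∈ units) ∧
      ((((Profile.zero.cons p.1).cons p.2.1).cons p.2.2.1).cons p.2.2.2).count = 17 := by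
    intro p
    simp only [D, Finset.mem_filter, Finset.mem_product, List.mem_toFinset]
  have himage : extremal 4 = (fun p : GaussianInt × GaussianInt × GaussianInt × GaussianInt =>
      word p.1 p.2.1 p.2.2.1 p.2.2.2) '' (D : Set _) := by
    ext x
    constructor
    · intro hx
      obtain ⟨v, hv, z, hz, rfl⟩ := exists_cons_of_mem_extremal hx
      obtain ⟨q, hq, t, ht, w, hw, rfl⟩ := hz.exists_word hv hx.2.2
      refine ⟨(q, t, w, v), (hmem _).2 ⟨⟨hq, ht, hw, hv⟩, ?_⟩, rfl⟩
      rw [← ((isProfile_word hq ht hw).cons hv).count_eq]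
      exact hx.2.2
    · rintro ⟨⟨q, t, w, v⟩, hp, rfl⟩
      obtain ⟨⟨hq, ht, hw, hv⟩, h17⟩ := (hmem _).1 hp
      have h := (isProfile_word hq ht hw).cons hv
      exact ⟨not_base_dvd_cons hv, h.hasNAFWeight, h.count_eq.trans h17⟩
  rw [himage, Set.InjOn.encard_image, Set.encard_coe_eq_coe_finsetCard, hD]
  · rfl
  · rintro ⟨q, t, w, v⟩ hp ⟨q', t', w', v'⟩ hp' h
    obtain ⟨⟨hq, ht, hw, hv⟩, -⟩ := (hmem _).1 hp
    obtain ⟨⟨hq', ht', hw', hv'⟩, -⟩ := (hmem _).1 hp'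
    obtain ⟨rfl, h⟩ := cons_inj hv hv' h
    obtain ⟨rfl, h⟩ := cons_inj hw hw' h
    obtain ⟨rfl, h⟩ := cons_inj ht ht' h
    obtain ⟨rfl, -⟩ := cons_inj hq hq' h
    rfl

lemma encard_extremal {n : ℕ} (hn : 4 ≤ n) : (extremal n).encard = 16 := by
  induction n, hn using Nat.le_induction with
  | base => exact encard_extremal_four
  | succ n hn ih =>
    obtain ⟨m, rfl⟩ := Nat.exists_eq_add_of_le' hn
    exact (encard_extremal_succ m).trans ih

/-! ### Optimal representations -/

/-- The 3-NAF condition in terms of pairs of digits. -/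
lemma isNAF_three_iff {s : List GaussianInt} {x : GaussianInt} :
    IsNAF 3 s x ↔ IsRepresentation s x ∧
      ∀ i k, i < k → k < i + 3 → digit s i ≠ 0 → digit s k = 0 := by
  refine and_congr_right fun _ => ⟨fun h i k hik hk hi => ?_, fun h j => ?_⟩
  · by_contra hk0
    have := Finset.card_le_one.1 (h i) i (by simp [hi]) k (by simp [hk0]; omega)
    omega
  · refine Finset.card_le_one.2 fun a ha b hb => ?_
    simp only [Finset.mem_filter, Finset.mem_Ico] at ha hb
    rcases lt_trichotomy a b with hab | hab | hab
    · exact absurd (h a b hab (by omega) ha.2) hb.2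
    · exact hab
    · exact absurd (h b a hab (by omega) hb.2) ha.2

lemma IsNAF.tail {d x : GaussianInt} {s : List GaussianInt} (h : IsNAF 3 (d :: s) x) :
    ∃ y, x = d + base * y ∧ IsNAF 3 s y := by
  obtain ⟨h, hsep⟩ := isNAF_three_iff.1 h
  obtain ⟨-, -, y, hy, hs⟩ := isRepresentation_cons.1 h
  exact ⟨y, hy, isNAF_three_iff.2 ⟨hs, fun i k hik hk hi =>
    hsep (i + 1) (k + 1) (by omega) (by omega) hi⟩⟩

lemma IsNAF.hasNAFWeight {x : GaussianInt} {s : List GaussianInt} (h : IsNAF 3 s x) :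
    HasNAFWeight (weight s) x := by
  induction hl : s.length using Nat.strong_induction_on generalizing s x with
  | _ l ih =>
    have h0 : HasNAFWeight (weight []) 0 := HasNAFWeight.zero
    cases s with
    | nil => rwa [isRepresentation_nil.1 h.1]
    | cons d s =>
      have hsep := (isNAF_three_iff.1 h).2
      have hd := (isRepresentation_cons.1 h.1).1
      obtain ⟨y, rfl, hs⟩ := h.tail
      rcases mem_digitSet.1 hd with rfl | hu
      · rw [weight_zero_cons, zero_add]
        exact (ih _ (by simp [← hl]) hs rfl).shift
      rw [weight_unit_cons hu]
      have hne : digit (d :: s) 0 ≠ 0 := ne_zero_of_mem_units hu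
      rcases s with - | ⟨d₁, s⟩
      · rw [isRepresentation_nil.1 hs.1]
        simpa using h0.cons hu
      obtain rfl : d₁ = 0 := hsep 0 1 (by norm_num) (by norm_num) hne
      obtain ⟨y₁, rfl, hs₁⟩ := hs.tail
      rcases s with - | ⟨d₂, s⟩
      · rw [isRepresentation_nil.1 hs₁.1]
        simpa [weight_zero_cons] using h0.cons hu
      obtain rfl : d₂ = 0 := hsep 0 2 (by norm_num) (by norm_num) hne
      obtain ⟨y₂, rfl, hs₂⟩ := hs₁.tail
      have := (ih _ (by rw [← hl]; simp only [List.length_cons]; omega) hs₂ rfl).cons hu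
      rw [weight_zero_cons, weight_zero_cons]
      convert this using 1
      ring

lemma IsNAF.cons_zero {x : GaussianInt} {s : List GaussianInt} (h : IsNAF 3 s x) (hs : s ≠ []) :
    IsNAF 3 (0 :: s) (base * x) := by
  obtain ⟨h, hsep⟩ := isNAF_three_iff.1 h
  refine isNAF_three_iff.2 ⟨isRepresentation_cons.2 ⟨mem_digitSet.2 (Or.inl rfl),
    fun h => absurd h hs, x, by simp, h⟩, fun i k hik hk hi => ?_⟩
  obtain _ | i := i
  · exact absurd rfl hi
  obtain _ | k := k
  · omega
  exact hsep i k (by omega) (by omega) hi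

lemma IsNAF.cons_unit {u x : GaussianInt} {s : List GaussianInt} (hu : u ∈ units)
    (h : IsNAF 3 s x) (h0 : digit s 0 = 0) (h1 : digit s 1 = 0) :
    IsNAF 3 (u :: s) (u + base * x) := by
  obtain ⟨h, hsep⟩ := isNAF_three_iff.1 h
  refine isNAF_three_iff.2 ⟨isRepresentation_cons.2 ⟨mem_digitSet.2 (Or.inr hu),
    fun _ => ne_zero_of_mem_units hu, x, rfl, h⟩, fun i k hik hk hi => ?_⟩
  obtain _ | k := k
  · omega
  obtain _ | i := i
  · obtain rfl | rfl : k = 0 ∨ k = 1 := by omega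
    · exact h0
    · exact h1
  exact hsep i k (by omega) (by omega) hi

lemma HasNAFWeight.exists_isNAF {n : ℕ} {x : GaussianInt} (h : HasNAFWeight n x) :
    ∃ s, IsNAF 3 s x ∧ weight s = n := by
  have hnil : IsNAF 3 [] 0 :=
    isNAF_three_iff.2 ⟨isRepresentation_nil.2 rfl, fun _ _ _ _ h => absurd rfl h⟩
  induction h with
  | zero => exact ⟨[], hnil, rfl⟩
  | @shift n z h ih =>
    obtain ⟨s, hs, hw⟩ := ih
    rcases eq_or_ne s [] with rfl | hne
    · rw [isRepresentation_nil.1 hs.1, mul_zero]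
      exact ⟨[], hnil, hw⟩
    · exact ⟨0 :: s, hs.cons_zero hne, by rw [weight_zero_cons, hw]⟩
  | @cons n z v hv h ih =>
    obtain ⟨s, hs, hw⟩ := ih
    rcases eq_or_ne s [] with rfl | hne
    · rw [isRepresentation_nil.1 hs.1]
      refine ⟨[v], ?_, by rw [weight_unit_cons hv, hw]⟩
      simpa using hnil.cons_unit hv rfl rfl
    · refine ⟨v :: 0 :: 0 :: s, ?_,
        by rw [weight_unit_cons hv, weight_zero_cons, weight_zero_cons, hw]⟩
      have := ((hs.cons_zero hne).cons_zero (by simp)).cons_unit hv rfl rfl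
      convert this using 1
      ring

/-- The 3-NAF is optimal, so the optimal representations are those of the weight of the 3-NAF. -/
lemma HasNAFWeight.numOptimal_eq {n : ℕ} {x : GaussianInt} (h : HasNAFWeight n x) :
    numOptimal x = count n x := by
  have hmin : ∀ t, IsRepresentation t x → n ≤ weight t := by
    intro t ht
    by_contra! hlt
    have h0 : count (weight t) (x + 0) = 0 := by
      refine h.count_eq_zero (by decide) ?_
      rw [show gain 0 = 0 by decide]
      omega
    rw [add_zero, count, Set.ncard_eq_zero (finite_representations _ _)] at h0
    exact Set.notMem_empty t (h0 ▸ ⟨ht, rfl⟩)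
  obtain ⟨s, hs, hw⟩ := h.exists_isNAF
  have hset : {t : List GaussianInt | IsOptimal t x} = representations n x := by
    ext t
    constructor
    · rintro ⟨ht, hle⟩
      have := hmin t ht
      have := hle s hs.1
      exact ⟨ht, by omega⟩
    · rintro ⟨ht, hn⟩
      refine ⟨ht, fun t' ht' => ?_⟩
      have := hmin t' ht'
      omega
  rw [numOptimal, hset, count, (finite_representations _ _).cast_ncard_eq]

end GaussianNAF

theorem mainTheorem1 (N : ℕ) (hN : 1 ≤ N) :
    (∀ (x : GaussianInt) (s : List GaussianInt),
      GaussianNAF.IsNAF 3 s x → GaussianNAF.weight s = N →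
        GaussianNAF.numOptimal x ≤ (GaussianNAF.r N : ℕ∞)) ∧
    (4 ≤ N →
      {x : GaussianInt | ¬ GaussianNAF.base ∣ x ∧
        (∃ s : List GaussianInt, GaussianNAF.IsNAF 3 s x ∧ GaussianNAF.weight s = N) ∧
        GaussianNAF.numOptimal x = (GaussianNAF.r N : ℕ∞)}.encard = 16) := by
  constructor
  · rintro x s hs rfl
    have h := hs.hasNAFWeight
    rw [h.numOptimal_eq]
    exact_mod_cast (h.bounds 1 (by decide)).le
  · intro hN4
    rw [← GaussianNAF.encard_extremal hN4]
    congr 1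
    ext x
    constructor
    · rintro ⟨hx, ⟨s, hs, rfl⟩, hr⟩
      have h := hs.hasNAFWeight
      rw [h.numOptimal_eq] at hr
      exact ⟨hx, h, by exact_mod_cast hr⟩
    · rintro ⟨hx, h, hr⟩
      exact ⟨hx, h.exists_isNAF, by rw [h.numOptimal_eq, hr]⟩
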